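/- A sporadic DAG task $\tau_i=(G_i,D_i,T_i)$ consists of a finite directed acyclic graph $G_i=(V_i,E_i)$ with a processing time $p_v\in\mathbb{Z}_{>0}$ for each vertex $v\in V_i$, a relative deadline $D_i\in\mathbb{Z}_{>0}$ and a period $T_i\in\mathbb{Z}_{>0}$. A task system is a tuple $\mathcal{T}=(\tau_1,\dots,\tau_n)$. It generates collections of jobs as follows: each task $\tau_i$ releases (finitely or infinitely many) dag-jobs at nonnegative integral times, any two at least $T_i$ apart; a dag-job of $\tau_i$ released at time $t$ consists of one job for every $v\in V_i$, with release date $t$, absolute deadline $t+D_i$ and processing time $p_v$, and for each $(v,w)\in E_i$ the job of $v$ is a predecessor of the job of $w$ in the same dag-job. Jobs are scheduled preemptively, with migration, in continuous time on $m$ identical processors of speed $s$: at each time a processor executes at most one job and a job is executed by at most one processor, and a job is completed once the total time for which it has been executed, multiplied by $s$, reaches its processing time. A job is available at time $t$ if it has been released by time $t$, all its predecessors have been completed, and it has not been completed itself. A schedule is valid if it executes only available jobs and completes every job by its deadline. EDF executes at any time $m$ available jobs with minimum absolute deadlines (all available jobs if there are fewer than $m$), breaking ties arbitrarily. The system $\mathcal{T}$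 is feasible on $m$ speed-$s$ processors if every collection of jobs it may generate has a valid schedule on them, and EDF-schedulable on $m$ speed-$s$ processors if, for every collection of jobs it may generate, EDF (which always produces a schedule) completes all jobs by their deadlines on these processors, however it breaks ties. Let $m\ge 1$ be an integer. Every sporadic DAG task system that is feasible on $m$ processors of unit speed is EDF-schedulable on $m$ processors of speed $2-1/m$. -/

import Mathlib

open MeasureTheory

noncomputable section

namespace SporadicDAG

/-- A sporadic DAG task `(G, D, T)`: a finite vertex-weighted directed acyclic graph whose vertices
are sequential jobs with positive integral processing times, a positive integral relative deadline
and a positive integral period. -/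
structure Task where
  /-- the vertices (jobs) of the graph -/
  V : Type*
  finite_V : Finite V
  /-- `Edge v w`: job `v` has to be completed before job `w` may begin -/
  Edge : V → V → Prop
  acyclic : ∀ v, ¬ Relation.TransGen Edge v v
  /-- the processing time (WCET) of a vertex -/
  wcet : V → ℕ
  wcet_pos : ∀ v, 0 < wcet v
  /-- the relative deadline `D` -/
  deadline : ℕ
  deadline_pos : 0 < deadline
  /-- the period `T` -/
  period : ℕ
  period_pos : 0 < period

/-- A task system `(τ₁, …, τₙ)`. -/
abbrev TaskSystem (n : ℕ) := Fin n → Task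

/-- A collection of (precedence-constrained) jobs. -/
structure JobCollection where
  Job : Type*
  /-- release date -/
  release : Job → ℕ
  /-- absolute deadline -/
  deadline : Job → ℕ
  /-- processing time -/
  proc : Job → ℕ
  /-- `Pred i j`: job `i` has to be completed before job `j` becomes eligible -/
  Pred : Job → Job → Prop

/-- A release pattern of a task system: for every task a finite or infinite set of time instants at
which it releases a dag-job, any two of them at least one period apart. -/
structure ReleasePattern {n : ℕ} (τ : TaskSystem n) where
  releases : Fin n → Set ℕ
  separated : ∀ i, ∀ t ∈ releases i, ∀ t' ∈ releases i, t < t' → t + (τ i).period ≤ t'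

/-- The collection of jobs generated by a task system under a release pattern. A job is given by
the index `i` of a task, a release instant `t` of that task, and a vertex `v` of its graph. -/
def ReleasePattern.jobs {n : ℕ} {τ : TaskSystem n} (R : ReleasePattern τ) : JobCollection where
  Job := (i : Fin n) × (R.releases i × (τ i).V)
  release j := j.2.1
  deadline j := j.2.1 + (τ j.1).deadline
  proc j := (τ j.1).wcet j.2.2
  Pred a b := ∃ (i : Fin n) (t : R.releases i) (v w : (τ i).V),
    (τ i).Edge v w ∧ a = ⟨i, t, v⟩ ∧ b = ⟨i, t, w⟩

/-- A preemptive schedule, with migration, of a collection of jobs on `m` identical processors: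
at every time each processor executes one job or idles, and no job is executed by two processors
at the same time. -/
structure Schedule (J : JobCollection) (m : ℕ) where
  assign : Fin m → ℝ → Option J.Job
  measurable_assign : ∀ k j, MeasurableSet {t : ℝ | assign k t = some j}
  sequential : ∀ t k k' j, assign k t = some j → assign k' t = some j → k = k'

namespace Schedule

variable {J : JobCollection} {m : ℕ}

/-- Job `j` is being executed at time `t`. -/
def Runs (S : Schedule J m) (j : J.Job) (t : ℝ) : Prop := ∃ k, S.assign k t = some j

/-- The amount of work done on job `j` before time `t` by processors of speed `s`. -/
def work (S : Schedule J m) (s : ℝ) (j : J.Job) (t : ℝ) : ℝ :=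
  s * volume.real {u : ℝ | 0 ≤ u ∧ u < t ∧ S.Runs j u}

/-- Job `j` has been completed by time `t`. -/
def Completed (S : Schedule J m) (s : ℝ) (j : J.Job) (t : ℝ) : Prop :=
  (J.proc j : ℝ) ≤ S.work s j t

/-- Job `j` is available at time `t`: it has been released, all its predecessors have been
completed, and it has not yet been completed itself. -/
def Available (S : Schedule J m) (s : ℝ) (j : J.Job) (t : ℝ) : Prop :=
  (J.release j : ℝ) ≤ t ∧ (∀ i, J.Pred i j → S.Completed s i t) ∧ ¬ S.Completed s j t

/-- Only available jobs are ever executed. -/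
def RespectsAvailability (S : Schedule J m) (s : ℝ) : Prop :=
  ∀ j t, S.Runs j t → S.Available s j t

/-- Every job is completed by its absolute deadline. -/
def MeetsDeadlines (S : Schedule J m) (s : ℝ) : Prop :=
  ∀ j, S.Completed s j (J.deadline j)

/-- A valid schedule on speed-`s` processors. -/
def IsValid (S : Schedule J m) (s : ℝ) : Prop :=
  S.RespectsAvailability s ∧ S.MeetsDeadlines s

/-- A schedule that EDF may produce on speed-`s` processors, ties being broken arbitrarily: at any
time `m` available jobs of minimum deadline are executed (all available jobs if there are at most
`m`). That is, only available jobs are executed, and if an available job is not executed then all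
processors are executing jobs whose deadline is not larger. -/
def IsEDF (S : Schedule J m) (s : ℝ) : Prop :=
  S.RespectsAvailability s ∧
    ∀ j t, S.Available s j t → ¬ S.Runs j t →
      ∀ k, ∃ i, S.assign k t = some i ∧ J.deadline i ≤ J.deadline j

end Schedule

/-- A task system is feasible on `m` speed-`s` processors if every collection of jobs that it may
generate has a valid schedule there. -/
def Feasible {n : ℕ} (τ : TaskSystem n) (m : ℕ) (s : ℝ) : Prop :=
  ∀ R : ReleasePattern τ, ∃ S : Schedule R.jobs m, S.IsValid s

/-- A task system is EDF-schedulable on `m` speed-`s` processors if, for every collection of jobs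
that it may generate, EDF produces a schedule there and meets all deadlines, however it breaks
ties. -/
def EDFSchedulable {n : ℕ} (τ : TaskSystem n) (m : ℕ) (s : ℝ) : Prop :=
  ∀ R : ReleasePattern τ,
    (∃ S : Schedule R.jobs m, S.IsEDF s) ∧
      ∀ S : Schedule R.jobs m, S.IsEDF s → S.MeetsDeadlines s

end SporadicDAG

end

/-!
Two things are proved about a collection of jobs generated by the task system: EDF meets all
deadlines, and EDF schedules exist.

*Deadlines.* Fix a deadline `d` and consider the jobs of deadline at most `d`. Jobs of one dag-job
share their deadline, so this set is closed under predecessors, and EDF schedules it without regard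
to the other jobs: a processor that is not executing one of its jobs witnesses that all of its
available jobs are being executed. `Schedule.IsEDF.sum_work_le` shows that at every integral time
`t` EDF at speed `s = 2 - 1 / m` has done at least as much work on these jobs as any
precedence-respecting unit-speed schedule `O`. If not, EDF lags behind `O` on some job `j`,
released at `r < t`. By Graham's argument (`Schedule.exists_chain_length`), throughout the time `y`
in `[r, t)` at which not all processors are busy, EDF works on a chain of jobs leading to `j`. On
this chain `O` has done strictly more work, sequentially at unit speed and after `r`; hence
`s * y ≤ t - r`. So EDF works at least `s * (m * (t - r) - (m - 1) * y) ≥ m * (t - r)` in `[r, t)`,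
which is the most that `O` can do there, and induction on the time covers `[0, r)`. At time
`t = d` a valid `O` has completed all these jobs, so EDF has completed them too
(`Schedule.IsEDF.meetsDeadlines`).

*Existence.* Cut time into slots of length `1 / (2 * m - 1)`. At speed `2 - 1 / m` a slot is worth
`1 / m` units of work, so that releases and, inductively, completions fall on slot boundaries.
Choosing available jobs of minimum deadline slot by slot is therefore EDF in continuous time
(`exists_isEDF`).
-/

namespace SporadicDAG

/-! ### Execution time and work -/

namespace Schedule

variable {J : JobCollection} {m : ℕ}

/-- The time for which job `j` is executed during `[a, b)`. -/
noncomputable def runTime (S : Schedule J m) (j : J.Job) (a b : ℝ) : ℝ :=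
  volume.real ({u : ℝ | S.Runs j u} ∩ Set.Ico a b)

lemma measurableSet_runs (S : Schedule J m) (j : J.Job) : MeasurableSet {u : ℝ | S.Runs j u} := by
  have h : {u : ℝ | S.Runs j u} = ⋃ k, {u : ℝ | S.assign k u = some j} := by
    ext u
    simp [Runs]
  rw [h]
  exact MeasurableSet.iUnion fun k => S.measurable_assign k j

lemma work_eq_mul_runTime (S : Schedule J m) (s : ℝ) (j : J.Job) (t : ℝ) :
    S.work s j t = s * S.runTime j 0 t := by
  unfold work runTime
  congr 2
  ext u
  simp only [Set.mem_ofPred_eq, Set.mem_inter_iff, Set.mem_Ico]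
  tauto

lemma runTime_nonneg (S : Schedule J m) (j : J.Job) (a b : ℝ) : 0 ≤ S.runTime j a b :=
  measureReal_nonneg

lemma volume_inter_Ico_ne_top (X : Set ℝ) (a b : ℝ) : volume (X ∩ Set.Ico a b) ≠ ⊤ :=
  ((measure_mono Set.inter_subset_right).trans_lt measure_Ico_lt_top).ne

lemma runTime_add (S : Schedule J m) (j : J.Job) {a b c : ℝ} (hab : a ≤ b) (hbc : b ≤ c) :
    S.runTime j a c = S.runTime j a b + S.runTime j b c := by
  unfold runTime
  rw [← Set.Ico_union_Ico_eq_Ico hab hbc, Set.inter_union_distrib_left]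
  refine measureReal_union ?_ ((S.measurableSet_runs j).inter measurableSet_Ico)
    (volume_inter_Ico_ne_top _ _ _) (volume_inter_Ico_ne_top _ _ _)
  exact (Set.Ico_disjoint_Ico_same).mono Set.inter_subset_right Set.inter_subset_right

lemma runTime_le (S : Schedule J m) (j : J.Job) {a b : ℝ} (hab : a ≤ b) :
    S.runTime j a b ≤ b - a := by
  unfold runTime
  calc _ ≤ volume.real (Set.Ico a b) := measureReal_mono Set.inter_subset_right (by simp)
    _ = b - a := by rw [Real.volume_real_Ico_of_le hab]

lemma work_eq_add (S : Schedule J m) (s : ℝ) (j : J.Job) {a b : ℝ} (ha : 0 ≤ a) (hab : a ≤ b) :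
    S.work s j b = S.work s j a + s * S.runTime j a b := by
  rw [work_eq_mul_runTime, work_eq_mul_runTime, S.runTime_add j ha hab, mul_add]

lemma work_of_nonpos (S : Schedule J m) (s : ℝ) (j : J.Job) {t : ℝ} (ht : t ≤ 0) :
    S.work s j t = 0 := by
  simp [work_eq_mul_runTime, runTime, Set.Ico_eq_empty (not_lt.mpr ht)]

lemma work_mono (S : Schedule J m) {s : ℝ} (hs : 0 ≤ s) (j : J.Job) {a b : ℝ} (hab : a ≤ b) :
    S.work s j a ≤ S.work s j b := by
  rw [work_eq_mul_runTime, work_eq_mul_runTime]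
  refine mul_le_mul_of_nonneg_left (measureReal_mono ?_ (volume_inter_Ico_ne_top _ _ _)) hs
  exact Set.inter_subset_inter_right _ (Set.Ico_subset_Ico_right hab)

lemma Completed.mono {S : Schedule J m} {s : ℝ} (hs : 0 ≤ s) {j : J.Job} {a b : ℝ}
    (h : S.Completed s j a) (hab : a ≤ b) : S.Completed s j b :=
  le_trans h (S.work_mono hs j hab)

lemma continuousOn_work (S : Schedule J m) {s : ℝ} (hs : 0 ≤ s) (j : J.Job) (t : ℝ) :
    ContinuousOn (S.work s j) (Set.Icc 0 t) := by
  refine LipschitzOnWith.continuousOn (K := s.toNNReal)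
    (LipschitzOnWith.of_le_add_mul _ fun x hx y hy => ?_)
  rw [Real.coe_toNNReal _ hs]
  rcases le_total x y with h | h
  · have := S.work_mono hs j h
    have := mul_nonneg hs (dist_nonneg (x := x) (y := y))
    linarith
  · rw [S.work_eq_add s j hy.1 h, Real.dist_eq, abs_of_nonneg (sub_nonneg.mpr h)]
    have := mul_le_mul_of_nonneg_left (S.runTime_le j h) hs
    linarith

/-- A job never receives more than its processing time, since it is not executed once completed. -/
lemma work_le_proc {S : Schedule J m} {s : ℝ} (hs : 0 ≤ s) (hS : S.RespectsAvailability s)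
    (j : J.Job) (t : ℝ) : S.work s j t ≤ J.proc j := by
  by_contra! hlt
  have ht : 0 ≤ t := by
    by_contra! h
    rw [S.work_of_nonpos s j h.le] at hlt
    exact absurd hlt (by simp)
  obtain ⟨u, hu, hwu⟩ := intermediate_value_Icc ht (S.continuousOn_work hs j t)
    (show (J.proc j : ℝ) ∈ Set.Icc _ _ by
      rw [S.work_of_nonpos s j le_rfl]
      exact ⟨by simp, hlt.le⟩)
  have h0 : S.runTime j u t = 0 := by
    have : {v : ℝ | S.Runs j v} ∩ Set.Ico u t = ∅ := by
      ext v
      simp only [Set.mem_inter_iff, Set.mem_ofPred_eq, Set.mem_Ico, Set.mem_empty_iff_false,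
        iff_false, not_and]
      intro hr huv
      exact absurd (Completed.mono hs (show S.Completed s j u from hwu.ge) huv) (hS j v hr).2.2
    simp [runTime, this]
  rw [S.work_eq_add s j hu.1 hu.2, h0, hwu] at hlt
  simp at hlt

end Schedule

/-! ### Collections of jobs generated by sporadic DAG tasks -/

/-- The properties of the collections of jobs generated by sporadic DAG tasks on which the analysis
rests: the jobs of a dag-job share their release date and deadline, precedence is well founded,
and only finitely many jobs are released in bounded time. -/
structure JobCollection.IsDagCollection (J : JobCollection) : Prop where
  release_eq : ∀ {i j}, J.Pred i j → J.release i = J.release j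
  deadline_eq : ∀ {i j}, J.Pred i j → J.deadline i = J.deadline j
  wf : WellFounded J.Pred
  proc_pos : ∀ j, 0 < J.proc j
  release_le_deadline : ∀ j, J.release j ≤ J.deadline j
  finite_release_le : ∀ t, {j | J.release j ≤ t}.Finite

lemma JobCollection.IsDagCollection.finite_deadline_le {J : JobCollection}
    (hJ : J.IsDagCollection) (d : ℕ) : {j | J.deadline j ≤ d}.Finite :=
  (hJ.finite_release_le d).subset fun j hj => (hJ.release_le_deadline j).trans hj

lemma ReleasePattern.isDagCollection_jobs {n : ℕ} {τ : TaskSystem n} (R : ReleasePattern τ) :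
    R.jobs.IsDagCollection where
  release_eq := by
    rintro _ _ ⟨i, t, v, w, -, rfl, rfl⟩
    rfl
  deadline_eq := by
    rintro _ _ ⟨i, t, v, w, -, rfl, rfl⟩
    rfl
  wf := by
    refine ⟨?_⟩
    rintro ⟨i, t, v⟩
    have := (τ i).finite_V
    have : IsTrans (τ i).V (Relation.TransGen (τ i).Edge) := ⟨fun _ _ _ => Relation.TransGen.trans⟩
    have : Std.Irrefl (Relation.TransGen (τ i).Edge) := ⟨(τ i).acyclic⟩
    have hwf : WellFounded (τ i).Edge :=
      Subrelation.wf (fun h => Relation.TransGen.single h)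
        (Finite.wellFounded_of_trans_of_irrefl (Relation.TransGen (τ i).Edge))
    induction v using hwf.induction with
    | _ v ih =>
      refine ⟨_, ?_⟩
      rintro _ ⟨i', t', v', w', he, rfl, hb⟩
      cases hb
      exact ih _ he
  proc_pos j := (τ j.1).wcet_pos _
  release_le_deadline j := Nat.le_add_right _ _
  finite_release_le t := by
    have hV := fun i => (τ i).finite_V
    have hfin : (Set.univ : Set ((i : Fin n) × (Fin (t + 1) × (τ i).V))).Finite := Set.finite_univ
    refine Set.Finite.of_finite_image
      (f := fun j : R.jobs.Job =>
        (⟨j.1, (Fin.ofNat (t + 1) (j.2.1 : ℕ), j.2.2)⟩ : (i : Fin n) × (Fin (t + 1) × (τ i).V)))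
      (hfin.subset (Set.subset_univ _)) ?_
    rintro ⟨i, ⟨a, ha⟩, v⟩ (hat : a ≤ t) ⟨i', ⟨b, hb⟩, w⟩ (hbt : b ≤ t) h
    simp only [Sigma.mk.injEq] at h
    obtain ⟨rfl, h⟩ := h
    simp only [heq_eq_eq, Prod.mk.injEq, Fin.ext_iff, Fin.val_ofNat] at h
    rw [Nat.mod_eq_of_lt (by omega), Nat.mod_eq_of_lt (by omega)] at h
    obtain ⟨rfl, rfl⟩ := h
    rfl

/-! ### Chains of predecessors -/

namespace Schedule

variable {J : JobCollection} {m : ℕ}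

/-- Graham's chain argument. `N` is a set of times at which `A` executes every available job of
deadline at most `d`. The witness `c` is the total processing time of a chain of predecessors
leading to `j`: the times in `N` before the completion of `j` are spent by `A` on this chain or on
`j`, while a unit-speed schedule cannot start `j` before it has executed the chain sequentially. -/
lemma exists_chain_length (hJ : J.IsDagCollection) {A O : Schedule J m} {s : ℝ} (hs : 0 ≤ s)
    (hA : A.RespectsAvailability s) (hO : O.RespectsAvailability 1) {N : Set ℝ} {d : ℕ}
    (hN : ∀ j, ∀ u ∈ N, J.deadline j ≤ d → A.Available s j u → A.Runs j u) (t : ℝ) (j : J.Job)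
    (hj : J.deadline j ≤ d) :
    ∃ c : ℝ,
      s * volume.real ((N ∩ {u | ¬ A.Completed s j u}) ∩ Set.Ico (J.release j : ℝ) t)
        ≤ c + A.work s j t ∧
      ∀ u, O.Runs j u → J.release j + c ≤ u := by
  induction j using hJ.wf.induction with
  | _ j ih =>
    by_cases hpred : ∃ i, J.Pred i j
    · have hfin : {i | J.Pred i j}.Finite :=
        (hJ.finite_deadline_le d).subset fun i hi => (hJ.deadline_eq hi).trans_le hj
      -- The sets of times at which the predecessors are not completed are nested; take the largest.
      obtain ⟨i, hi⟩ := hfin.exists_maximalFor (fun i => {u : ℝ | ¬ A.Completed s i u}) _ hpred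
      have hij : J.Pred i j := hi.prop
      have hmax : ∀ i', J.Pred i' j → ∀ u, ¬ A.Completed s i' u → ¬ A.Completed s i u := by
        intro i' hi' u hu hcu
        refine hi.2 hi' (fun v hv hv' => ?_) hu hcu
        rcases le_total u v with h | h
        · exact hv (hcu.mono hs h)
        · exact hu (hv'.mono hs h)
      obtain ⟨c, hc1, hc2⟩ := ih i hij ((hJ.deadline_eq hij).trans_le hj)
      rw [hJ.release_eq hij] at hc1 hc2
      refine ⟨c + J.proc i, ?_, ?_⟩
      · have hsub : (N ∩ {u | ¬ A.Completed s j u}) ∩ Set.Ico (J.release j : ℝ) t ⊆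
            ((N ∩ {u | ¬ A.Completed s i u}) ∩ Set.Ico (J.release j : ℝ) t) ∪
              ({u | A.Runs j u} ∩ Set.Ico 0 t) := by
          rintro u ⟨⟨huN, huj⟩, hur, hut⟩
          by_cases hui : A.Completed s i u
          · right
            refine ⟨hN j u huN hj ⟨hur, fun i' hi' => ?_, huj⟩, (Nat.cast_nonneg _).trans hur, hut⟩
            by_contra h
            exact hmax i' hi' u h hui
          · exact Or.inl ⟨⟨huN, hui⟩, hur, hut⟩
        have h1 := (measureReal_mono hsub (measure_union_ne_top (volume_inter_Ico_ne_top _ _ _)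
          (volume_inter_Ico_ne_top _ _ _))).trans (measureReal_union_le _ _)
        have h2 := mul_le_mul_of_nonneg_left h1 hs
        have h3 := work_le_proc hs hA i t
        have h4 := A.work_eq_mul_runTime s j t
        unfold runTime at h4
        rw [mul_add] at h2
        linarith
      · intro u hu
        have h1 : (J.proc i : ℝ) ≤ O.work 1 i u := (hO j u hu).2.1 i hij
        rw [work_eq_mul_runTime, one_mul] at h1
        have h2 : O.runTime i 0 u ≤ volume.real (Set.Ico (J.release j + c) u) := by
          refine measureReal_mono ?_ (by simp)
          rintro v ⟨hv, -, hvu⟩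
          exact ⟨hc2 v hv, hvu⟩
        have h3 : (0 : ℝ) < J.proc i := by exact_mod_cast hJ.proc_pos i
        rw [Real.volume_real_Ico] at h2
        rcases le_max_iff.mp (h1.trans h2) with h | h <;> linarith
    · push Not at hpred
      refine ⟨0, ?_, fun u hu => by simpa using (hO j u hu).1⟩
      rw [zero_add, work_eq_mul_runTime]
      refine mul_le_mul_of_nonneg_left (measureReal_mono ?_ (volume_inter_Ico_ne_top _ _ _)) hs
      rintro u ⟨⟨huN, huj⟩, hur, hut⟩
      exact ⟨hN j u huN hj ⟨hur, fun i hi => absurd hi (hpred i), huj⟩,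
        (Nat.cast_nonneg _).trans hur, hut⟩

/-- A released job that is not completed has an available ancestor, possibly itself. -/
lemma exists_available (hJ : J.IsDagCollection) (S : Schedule J m) (s : ℝ) {u : ℝ} (j : J.Job)
    (hr : (J.release j : ℝ) ≤ u) (hc : ¬ S.Completed s j u) :
    ∃ i, J.deadline i = J.deadline j ∧ S.Available s i u := by
  induction j using hJ.wf.induction with
  | _ j ih =>
    by_cases h : ∀ i, J.Pred i j → S.Completed s i u
    · exact ⟨j, rfl, hr, h, hc⟩
    · push Not at h
      obtain ⟨i, hij, hi⟩ := h
      obtain ⟨i', h1, h2⟩ := ih i hij (by rwa [hJ.release_eq hij]) hi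
      exact ⟨i', h1.trans (hJ.deadline_eq hij), h2⟩

/-! ### Counting the jobs in execution -/

/-- The times at which some processor executes no job of `F`. -/
def idleSet (S : Schedule J m) (F : Finset J.Job) : Set ℝ :=
  {u | ∃ k, ∀ j ∈ F, S.assign k u ≠ some j}

lemma measurableSet_idleSet (S : Schedule J m) (F : Finset J.Job) :
    MeasurableSet (S.idleSet F) := by
  have h : S.idleSet F = ⋃ k, ⋂ j ∈ F, {u : ℝ | S.assign k u = some j}ᶜ := by
    ext u
    simp [idleSet]
  rw [h]
  exact MeasurableSet.iUnion fun k =>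
    F.measurableSet_biInter fun j _ => (S.measurable_assign k j).compl

open Classical in
/-- The number of jobs of `F` being executed at time `u`. -/
noncomputable def runCount (S : Schedule J m) (F : Finset J.Job) (u : ℝ) : ℕ :=
  (F.filter fun j => S.Runs j u).card

lemma runCount_le (S : Schedule J m) (F : Finset J.Job) (u : ℝ) : S.runCount F u ≤ m := by
  classical
  have hsub : (F.filter fun j => S.Runs j u).map .some ⊆
      (Finset.univ : Finset (Fin m)).image fun k => S.assign k u := by
    intro x hx
    obtain ⟨j, hj, rfl⟩ := Finset.mem_map.mp hx
    obtain ⟨k, hk⟩ := (Finset.mem_filter.mp hj).2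
    exact Finset.mem_image.mpr ⟨k, Finset.mem_univ _, hk⟩
  have h := (Finset.card_le_card hsub).trans Finset.card_image_le
  rwa [Finset.card_map, Finset.card_univ, Fintype.card_fin] at h

lemma le_runCount_of_notMem_idleSet {S : Schedule J m} {F : Finset J.Job} {u : ℝ}
    (hu : u ∉ S.idleSet F) : m ≤ S.runCount F u := by
  classical
  simp only [idleSet, Set.mem_ofPred_eq, not_exists, not_forall, not_not] at hu
  choose f hf hf' using hu
  have := Finset.card_le_card_of_injOn (s := (Finset.univ : Finset (Fin m)))
    (t := F.filter (fun j => S.Runs j u)) f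
    (fun k _ => by simpa using ⟨hf k, k, hf' k⟩) (by
      intro a _ b _ hab
      exact S.sequential u a b (f a) (hf' a) (by rw [hab]; exact hf' b))
  simpa [runCount] using this

lemma runCount_eq_sum_indicator (S : Schedule J m) (F : Finset J.Job) (u : ℝ) :
    (S.runCount F u : ℝ) = ∑ j ∈ F, {v : ℝ | S.Runs j v}.indicator 1 u := by
  classical
  simp [runCount, Set.indicator_apply]

lemma integrableOn_indicator_runs (S : Schedule J m) (j : J.Job) (a b : ℝ) :
    IntegrableOn ({v : ℝ | S.Runs j v}.indicator (1 : ℝ → ℝ)) (Set.Ico a b) :=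
  Integrable.indicator (integrableOn_const (by simp)) (S.measurableSet_runs j)

lemma integrableOn_runCount (S : Schedule J m) (F : Finset J.Job) (a b : ℝ) :
    IntegrableOn (fun u => (S.runCount F u : ℝ)) (Set.Ico a b) := by
  simp_rw [runCount_eq_sum_indicator]
  exact integrable_finsetSum _ fun j _ => S.integrableOn_indicator_runs j a b

lemma sum_runTime_eq_integral (S : Schedule J m) (F : Finset J.Job) (a b : ℝ) :
    ∑ j ∈ F, S.runTime j a b = ∫ u in Set.Ico a b, (S.runCount F u : ℝ) := by
  simp_rw [runCount_eq_sum_indicator]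
  rw [integral_finsetSum _ fun j _ => S.integrableOn_indicator_runs j a b]
  refine Finset.sum_congr rfl fun j _ => ?_
  rw [integral_indicator_one (S.measurableSet_runs j),
    measureReal_restrict_apply (S.measurableSet_runs j), runTime]

lemma sum_runTime_le (S : Schedule J m) (F : Finset J.Job) {a b : ℝ} (hab : a ≤ b) :
    ∑ j ∈ F, S.runTime j a b ≤ m * (b - a) := by
  rw [sum_runTime_eq_integral]
  calc _ ≤ ∫ _ in Set.Ico a b, (m : ℝ) :=
        setIntegral_mono_on (S.integrableOn_runCount F a b) (integrableOn_const (by simp))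
          measurableSet_Ico fun u _ => by exact_mod_cast S.runCount_le F u
    _ = m * (b - a) := by
        rw [setIntegral_const, Real.volume_real_Ico_of_le hab, smul_eq_mul, mul_comm]

/-- If at least one job of `F` is executed throughout `[a, b)`, then only the times of `idleSet`
fall short of executing `m` of them, and by at most `m - 1` jobs. -/
lemma le_sum_runTime (S : Schedule J m) (F : Finset J.Job) {a b : ℝ} (hab : a ≤ b)
    (h : ∀ u ∈ Set.Ico a b, 1 ≤ S.runCount F u) :
    m * (b - a) - (m - 1) * volume.real (S.idleSet F ∩ Set.Ico a b)
      ≤ ∑ j ∈ F, S.runTime j a b := by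
  have hind : IntegrableOn ((S.idleSet F).indicator (1 : ℝ → ℝ)) (Set.Ico a b) :=
    Integrable.indicator (integrableOn_const (by simp)) (S.measurableSet_idleSet F)
  have hconst : IntegrableOn (fun _ => (m : ℝ)) (Set.Ico a b) := integrableOn_const (by simp)
  rw [sum_runTime_eq_integral]
  calc _ = ∫ u in Set.Ico a b, ((m : ℝ) - (m - 1) * (S.idleSet F).indicator 1 u) := by
        rw [integral_sub hconst (hind.const_mul _), integral_const_mul,
          integral_indicator_one (S.measurableSet_idleSet F),
          measureReal_restrict_apply (S.measurableSet_idleSet F), setIntegral_const,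
          Real.volume_real_Ico_of_le hab, smul_eq_mul, mul_comm (b - a)]
    _ ≤ _ := by
        refine setIntegral_mono_on (hconst.sub (hind.const_mul _)) (S.integrableOn_runCount F a b)
          measurableSet_Ico fun u hu => ?_
        by_cases huN : u ∈ S.idleSet F
        · have : (1 : ℝ) ≤ S.runCount F u := by exact_mod_cast h u hu
          simpa [Set.indicator_of_mem huN] using this
        · have : (m : ℝ) ≤ S.runCount F u := by exact_mod_cast le_runCount_of_notMem_idleSet huN
          simpa [Set.indicator_of_notMem huN] using this

/-! ### EDF at speed `2 - 1 / m` against a unit-speed schedule -/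

/-- At integral times, EDF at speed `2 - 1 / m` has done at least as much work on the jobs of
deadline at most `d` as any precedence-respecting schedule at unit speed. -/
lemma IsEDF.sum_work_le (hm : 0 < m) (hJ : J.IsDagCollection) {A O : Schedule J m}
    (hA : A.IsEDF (2 - 1 / (m : ℝ))) (hO : O.RespectsAvailability 1) {d : ℕ} {F : Finset J.Job}
    (hF : ∀ j, j ∈ F ↔ J.deadline j ≤ d) (t : ℕ) :
    ∑ j ∈ F, O.work 1 j t ≤ ∑ j ∈ F, A.work (2 - 1 / (m : ℝ)) j t := by
  have hm1 : (1 : ℝ) ≤ m := by exact_mod_cast hm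
  set s : ℝ := 2 - 1 / (m : ℝ) with hs
  have hsm : s * m = 2 * m - 1 := by rw [hs]; field_simp
  have hs0 : 0 < s := by nlinarith
  induction t using Nat.strong_induction_on with
  | _ t ih =>
    by_cases hall : ∀ j ∈ F, O.work 1 j t ≤ A.work s j t
    · exact Finset.sum_le_sum hall
    push Not at hall
    obtain ⟨j, hjF, hlt⟩ := hall
    have hjd := (hF j).mp hjF
    have hinc : ∀ u ≤ (t : ℝ), ¬ A.Completed s j u := fun u hu hc => by
      have h1 : (J.proc j : ℝ) ≤ A.work s j t := hc.mono hs0.le hu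
      have h2 := work_le_proc zero_le_one hO j t
      linarith
    have hN : ∀ i, ∀ u ∈ A.idleSet F, J.deadline i ≤ d → A.Available s i u → A.Runs i u := by
      rintro i u ⟨k, hk⟩ hi hav
      by_contra hrun
      obtain ⟨i', h1, h2⟩ := hA.2 i u hav hrun k
      exact hk i' ((hF i').mpr (h2.trans hi)) h1
    obtain ⟨c, hc1, hc2⟩ := exists_chain_length hJ hs0.le hA.1 hO hN t j hjd
    set r : ℕ := J.release j
    have hset : (A.idleSet F ∩ {u | ¬ A.Completed s j u}) ∩ Set.Ico (r : ℝ) t =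
        A.idleSet F ∩ Set.Ico (r : ℝ) t := by
      ext u
      simp only [Set.mem_inter_iff, Set.mem_ofPred_eq, Set.mem_Ico]
      exact ⟨fun h => ⟨h.1.1, h.2⟩, fun h => ⟨⟨h.1, hinc u h.2.2.le⟩, h.2⟩⟩
    rw [hset] at hc1
    set y := volume.real (A.idleSet F ∩ Set.Ico (r : ℝ) t)
    have hA0 : 0 ≤ A.work s j t := by
      rw [work_eq_mul_runTime]
      exact mul_nonneg hs0.le (A.runTime_nonneg _ _ _)
    have hOj : O.work 1 j t ≤ max (t - (r + c)) 0 := by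
      rw [work_eq_mul_runTime, one_mul, ← Real.volume_real_Ico]
      refine measureReal_mono ?_ (by simp)
      rintro u ⟨hu, -, hut⟩
      exact ⟨hc2 u hu, hut⟩
    have hrt : r < t := by
      by_contra! htr
      have h0 : O.runTime j 0 t = 0 := by
        have : {u : ℝ | O.Runs j u} ∩ Set.Ico 0 (t : ℝ) = ∅ := by
          ext u
          simp only [Set.mem_inter_iff, Set.mem_ofPred_eq, Set.mem_Ico, Set.mem_empty_iff_false,
            iff_false, not_and, not_lt]
          intro hu _
          exact le_trans (by exact_mod_cast htr) (hO j u hu).1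
        simp [runTime, this]
      rw [O.work_eq_mul_runTime, h0] at hlt
      linarith
    have hrt' : (r : ℝ) ≤ t := by exact_mod_cast hrt.le
    -- The idle time is bounded through the chain leading to `j`.
    have hy : s * y ≤ t - r := by
      rcases le_max_iff.mp (hlt.le.trans hOj) with h | h
      · linarith
      · rcases le_max_iff.mp hOj with h' | h' <;> linarith
    have hcount : ∀ u ∈ Set.Ico (r : ℝ) t, 1 ≤ A.runCount F u := by
      intro u hu
      by_cases huN : u ∈ A.idleSet F
      · obtain ⟨i, hi, hav⟩ := exists_available hJ A s j hu.1 (hinc u hu.2.le)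
        have hid : J.deadline i ≤ d := hi.trans_le hjd
        classical
        exact Finset.card_pos.mpr ⟨i, Finset.mem_filter.mpr ⟨(hF i).mpr hid, hN i u huN hid hav⟩⟩
      · exact hm.trans_le (le_runCount_of_notMem_idleSet huN)
    have hAsum := mul_le_mul_of_nonneg_left (A.le_sum_runTime F hrt' hcount) hs0.le
    have hOsum := O.sum_runTime_le F hrt'
    have hsplit : ∀ (S : Schedule J m) (v : ℝ), ∑ i ∈ F, S.work v i t =
        ∑ i ∈ F, S.work v i r + v * ∑ i ∈ F, S.runTime i r t := by
      intro S v
      rw [Finset.mul_sum, ← Finset.sum_add_distrib]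
      exact Finset.sum_congr rfl fun i _ => S.work_eq_add v i (Nat.cast_nonneg r) hrt'
    rw [hsplit, hsplit, one_mul]
    have hind := ih r hrt
    -- `s * (m * (t - r) - (m - 1) * y) ≥ (s * m - (m - 1)) * (t - r) = m * (t - r)`
    have key : m * ((t : ℝ) - r) ≤ s * (m * (t - r) - (m - 1) * y) := by
      have h1 := mul_le_mul_of_nonneg_left hy (sub_nonneg.mpr hm1)
      have h2 : s * (m * ((t : ℝ) - r) - (m - 1) * y) =
          (s * m) * (t - r) - (m - 1) * (s * y) := by ring
      rw [h2, hsm]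
      linarith
    linarith

/-- EDF at speed `2 - 1 / m` meets all deadlines as soon as some unit-speed schedule does: at a
deadline `d`, it must have finished the jobs of deadline at most `d`, because the valid schedule
has. -/
lemma IsEDF.meetsDeadlines (hm : 0 < m) (hJ : J.IsDagCollection) {A O : Schedule J m}
    (hA : A.IsEDF (2 - 1 / (m : ℝ))) (hO : O.IsValid 1) :
    A.MeetsDeadlines (2 - 1 / (m : ℝ)) := by
  have hm1 : (1 : ℝ) ≤ m := by exact_mod_cast hm
  have hs0 : (0 : ℝ) ≤ 2 - 1 / (m : ℝ) := by
    have := (div_le_one (by linarith)).mpr hm1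
    linarith
  intro j
  set d := J.deadline j
  have hF : ∀ i, i ∈ (hJ.finite_deadline_le d).toFinset ↔ J.deadline i ≤ d := by simp
  have hsum := hA.sum_work_le hm hJ hO.1 hF d
  by_contra hj
  refine absurd hsum (not_le.mpr (Finset.sum_lt_sum (fun i hi => ?_) ⟨j, (hF j).mpr le_rfl, ?_⟩))
  · exact (work_le_proc hs0 hA.1 i d).trans
      ((hO.2 i).mono zero_le_one (by exact_mod_cast (hF i).mp hi))
  · exact (not_le.mp hj).trans_le (hO.2 j)

end Schedule

/-! ### Existence of EDF schedules -/

/-- From a finite set, `m` processors can choose elements of minimum key. -/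
lemma exists_selection {α : Type*} (m : ℕ) (key : α → ℕ) {X : Set α} (hX : X.Finite) :
    ∃ g : Fin m → Option α,
      (∀ k j, g k = some j → j ∈ X) ∧
      (∀ k k' j, g k = some j → g k' = some j → k = k') ∧
      ∀ j ∈ X, (¬ ∃ k, g k = some j) → ∀ k, ∃ i, g k = some i ∧ key i ≤ key j := by
  classical
  set l := hX.toFinset.toList.mergeSort (fun a b => decide (key a ≤ key b)) with hl
  have hmem : ∀ j, j ∈ l ↔ j ∈ X := by simp [hl]
  have hnd : l.Nodup := (List.mergeSort_perm _ _).nodup_iff.mpr (Finset.nodup_toList _)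
  have hsorted : l.Pairwise (fun a b => key a ≤ key b) := by
    have := List.pairwise_mergeSort (le := fun a b => decide (key a ≤ key b))
      (fun a b c => by simpa using le_trans) (fun a b => by simpa using le_total _ _)
      hX.toFinset.toList
    simpa [← hl] using this
  refine ⟨fun k => l[(k : ℕ)]?, ?_, ?_, ?_⟩
  · intro k j h
    exact (hmem j).mp (List.mem_of_getElem? h)
  · intro k k' j h h'
    obtain ⟨hk, hkj⟩ := List.getElem?_eq_some_iff.mp h
    obtain ⟨hk', hkj'⟩ := List.getElem?_eq_some_iff.mp h'
    exact Fin.ext ((hnd.getElem_inj_iff).mp (hkj.trans hkj'.symm))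
  · intro j hj hno k
    obtain ⟨p, hp, rfl⟩ := List.mem_iff_getElem.mp ((hmem j).mpr hj)
    have hmp : m ≤ p := by
      by_contra! h
      exact hno ⟨⟨p, h⟩, List.getElem?_eq_getElem hp⟩
    have hkp : (k : ℕ) < p := k.2.trans_le hmp
    exact ⟨l[(k : ℕ)], List.getElem?_eq_getElem (hkp.trans hp),
      List.pairwise_iff_getElem.mp hsorted _ _ (hkp.trans hp) hp hkp⟩

variable {J : JobCollection} {m : ℕ}

/-- The jobs available in the slot `k`, that is, at the times in `[k, k + 1) / (2 * m - 1)`, when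
every job `j` has been executed in `c j` of the preceding slots. At speed `2 - 1 / m` a slot
contributes `1 / m` units of work, so `j` needs exactly `m * J.proc j` slots. -/
def slotAvailable (J : JobCollection) (m : ℕ) (c : J.Job → ℕ) (k : ℕ) : Set J.Job :=
  {j | J.release j * (2 * m - 1) ≤ k ∧ (∀ i, J.Pred i j → m * J.proc i ≤ c i) ∧
    c j < m * J.proc j}

lemma finite_slotAvailable (hJ : J.IsDagCollection) (hm : 0 < m) (c : J.Job → ℕ) (k : ℕ) :
    (slotAvailable J m c k).Finite :=
  (hJ.finite_release_le k).subset fun _ hj =>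
    (Nat.le_mul_of_pos_right _ (by omega)).trans hj.1

open Classical in
/-- `g k` is the assignment of the processors in the slot `k`, and `c k j` is the number of the
first `k` slots in which `j` is executed; in each slot, `g` follows EDF. -/
structure IsSlotEDF (J : JobCollection) (m : ℕ) (g : ℕ → Fin m → Option J.Job)
    (c : ℕ → J.Job → ℕ) : Prop where
  count_zero : ∀ j, c 0 j = 0
  count_succ : ∀ k j, c (k + 1) j = c k j + if ∃ p, g k p = some j then 1 else 0
  mem_available : ∀ k p j, g k p = some j → j ∈ slotAvailable J m (c k) k
  sequential : ∀ k p p' j, g k p = some j → g k p' = some j → p = p'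
  edf : ∀ k, ∀ j ∈ slotAvailable J m (c k) k, (¬ ∃ p, g k p = some j) →
    ∀ p, ∃ i, g k p = some i ∧ J.deadline i ≤ J.deadline j

lemma exists_isSlotEDF (hJ : J.IsDagCollection) (hm : 0 < m) : ∃ g c, IsSlotEDF J m g c := by
  classical
  choose sel h1 h2 h3 using fun (c : J.Job → ℕ) (k : ℕ) =>
    exists_selection m J.deadline (finite_slotAvailable hJ hm c k)
  let c : ℕ → J.Job → ℕ := fun k =>
    Nat.rec (fun _ => 0) (fun k ck j => ck j + if ∃ p, sel ck k p = some j then 1 else 0) k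
  refine ⟨fun k => sel (c k) k, c, fun _ => rfl, fun k j => ?_, fun k => h1 _ _, fun k => h2 _ _,
    fun k => h3 _ _⟩
  simp only [c]

/-- The schedule that assigns the processors according to `g k` during
`[k / N, (k + 1) / N)`, for every natural number `k`. -/
noncomputable def slotSchedule (N : ℕ) (g : ℕ → Fin m → Option J.Job)
    (hg : ∀ k p p' j, g k p = some j → g k p' = some j → p = p') : Schedule J m where
  assign p t := if 0 ≤ t then g ⌊t * N⌋₊ p else none
  measurable_assign p j := by
    have h : {t : ℝ | (if 0 ≤ t then g ⌊t * N⌋₊ p else none) = some j} =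
        Set.Ici 0 ∩ (fun t : ℝ => ⌊t * N⌋₊) ⁻¹' {k | g k p = some j} := by
      ext t
      by_cases ht : 0 ≤ t <;> simp [ht]
    rw [h]
    exact measurableSet_Ici.inter
      ((Nat.measurable_floor.comp (measurable_id.mul_const (N : ℝ))) MeasurableSet.of_discrete)
  sequential t p p' j h h' := by
    split_ifs at h h'
    exact hg _ _ _ _ h h'

section SlotSchedule

variable {N : ℕ} {g : ℕ → Fin m → Option J.Job}
  {hg : ∀ k p p' j, g k p = some j → g k p' = some j → p = p'}

lemma runs_slotSchedule_iff {j : J.Job} {t : ℝ} :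
    (slotSchedule N g hg).Runs j t ↔ 0 ≤ t ∧ ∃ p, g ⌊t * N⌋₊ p = some j := by
  by_cases ht : 0 ≤ t <;> simp [slotSchedule, Schedule.Runs, ht]

open Classical in
lemma runTime_slotSchedule (hN : 0 < N) (j : J.Job) {k : ℕ} {t : ℝ} (hkt : (k : ℝ) / N ≤ t)
    (htk : t ≤ (k + 1) / N) :
    (slotSchedule N g hg).runTime j (k / N) t =
      if ∃ p, g k p = some j then t - k / N else 0 := by
  have hN' : (0 : ℝ) < N := by exact_mod_cast hN
  have hfloor : ∀ u ∈ Set.Ico ((k : ℝ) / N) t,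
      ((slotSchedule N g hg).Runs j u ↔ ∃ p, g k p = some j) := by
    intro u hu
    have h0 : 0 ≤ u := le_trans (by positivity) hu.1
    have : ⌊u * N⌋₊ = k := by
      rw [Nat.floor_eq_iff (by positivity)]
      exact ⟨(div_le_iff₀ hN').mp hu.1, (lt_div_iff₀ hN').mp (hu.2.trans_le htk)⟩
    rw [runs_slotSchedule_iff, this]
    simp [h0]
  unfold Schedule.runTime
  split_ifs with h
  · have : {u | (slotSchedule N g hg).Runs j u} ∩ Set.Ico ((k : ℝ) / N) t =
        Set.Ico ((k : ℝ) / N) t :=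
      Set.inter_eq_right.mpr fun u hu => (hfloor u hu).mpr h
    rw [this, Real.volume_real_Ico_of_le hkt]
  · have : {u | (slotSchedule N g hg).Runs j u} ∩ Set.Ico ((k : ℝ) / N) t = ∅ := by
      ext u
      simp only [Set.mem_inter_iff, Set.mem_ofPred_eq, Set.mem_empty_iff_false, iff_false, not_and]
      exact fun hr hu => h ((hfloor u hu).mp hr)
    simp [this]

end SlotSchedule

namespace IsSlotEDF

variable {g : ℕ → Fin m → Option J.Job} {c : ℕ → J.Job → ℕ}

lemma work_slot_boundary (h : IsSlotEDF J m g c) {N : ℕ} (hN : 0 < N) {s : ℝ}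
    (hs : s = N / m) (j : J.Job) (k : ℕ) :
    (slotSchedule N g h.sequential).work s j (k / N) = c k j / m := by
  have hN' : (0 : ℝ) < N := by exact_mod_cast hN
  induction k with
  | zero => simp [h.count_zero, Schedule.work_of_nonpos]
  | succ k ih =>
    have hle : (k : ℝ) / N ≤ ((k + 1 : ℕ) : ℝ) / N := by
      push_cast
      gcongr
      linarith
    rw [Schedule.work_eq_add _ s j (by positivity) hle, ih,
      runTime_slotSchedule hN j hle (by push_cast; rfl), h.count_succ, hs]
    split_ifs
    · push_cast
      field_simp
      ring
    · simp

/-- Completion takes place at slot boundaries only. -/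
lemma completed_iff (h : IsSlotEDF J m g c) (hm : 0 < m) {N : ℕ} (hN : 0 < N) {s : ℝ}
    (hs : s = N / m) (j : J.Job) {t : ℝ} (ht : 0 ≤ t) :
    (slotSchedule N g h.sequential).Completed s j t ↔ m * J.proc j ≤ c ⌊t * N⌋₊ j := by
  have hN' : (0 : ℝ) < N := by exact_mod_cast hN
  have hm' : (0 : ℝ) < m := by exact_mod_cast hm
  set k := ⌊t * N⌋₊ with hk
  have hkt : (k : ℝ) / N ≤ t := (div_le_iff₀ hN').mpr (Nat.floor_le (by positivity))
  have htk : t < (k + 1) / N := (lt_div_iff₀ hN').mpr (Nat.lt_floor_add_one _)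
  have hbase : (J.proc j : ℝ) ≤ c k j / m ↔ m * J.proc j ≤ c k j := by
    rw [le_div_iff₀ hm', mul_comm]
    exact_mod_cast Iff.rfl
  unfold Schedule.Completed
  rw [Schedule.work_eq_add _ s j (by positivity) hkt, h.work_slot_boundary hN hs,
    runTime_slotSchedule hN j hkt htk.le]
  split_ifs with hrun
  · obtain ⟨p, hp⟩ := hrun
    have hlt := (h.mem_available k p j hp).2.2
    refine iff_of_false ?_ (not_le.mpr hlt)
    -- An executed job lacks at least one slot, and less than one slot has elapsed.
    have h1 : ((c k j : ℝ) + 1) / m ≤ J.proc j := by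
      rw [div_le_iff₀ hm', mul_comm]
      exact_mod_cast hlt
    have h2 : s * (t - k / N) < 1 / m := by
      have h3 : t - k / N < 1 / N := by
        rw [add_div] at htk
        linarith
      calc s * (t - k / N) < s * (1 / N) := mul_lt_mul_of_pos_left h3 (by rw [hs]; positivity)
        _ = 1 / m := by rw [hs]; field_simp
    rw [add_div] at h1
    linarith
  · simpa using hbase

lemma available_iff (h : IsSlotEDF J m g c) (hm : 0 < m) {s : ℝ}
    (hs : s = (2 * m - 1 : ℕ) / m) (j : J.Job) {t : ℝ} (ht : 0 ≤ t) :
    (slotSchedule (2 * m - 1) g h.sequential).Available s j t ↔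
      j ∈ slotAvailable J m (c ⌊t * (2 * m - 1 : ℕ)⌋₊) ⌊t * (2 * m - 1 : ℕ)⌋₊ := by
  have hN : 0 < 2 * m - 1 := by omega
  have hrel : (J.release j : ℝ) ≤ t ↔
      J.release j * (2 * m - 1) ≤ ⌊t * (2 * m - 1 : ℕ)⌋₊ := by
    rw [Nat.le_floor_iff (by positivity), Nat.cast_mul,
      mul_le_mul_iff_left₀ (by exact_mod_cast hN)]
  unfold Schedule.Available
  simp only [h.completed_iff hm hN hs _ ht, hrel, not_le]
  rfl

lemma isEDF (h : IsSlotEDF J m g c) (hm : 0 < m) {s : ℝ} (hs : s = (2 * m - 1 : ℕ) / m) :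
    (slotSchedule (2 * m - 1) g h.sequential).IsEDF s := by
  constructor
  · intro j t hr
    obtain ⟨ht, p, hp⟩ := runs_slotSchedule_iff.mp hr
    exact (h.available_iff hm hs j ht).mpr (h.mem_available _ p j hp)
  · intro j t hav hrun p
    have ht : 0 ≤ t := (Nat.cast_nonneg _).trans hav.1
    obtain ⟨i, hi, hle⟩ := h.edf _ j ((h.available_iff hm hs j ht).mp hav)
      (fun hex => hrun (runs_slotSchedule_iff.mpr ⟨ht, hex⟩)) p
    exact ⟨i, by simpa [slotSchedule, ht] using hi, hle⟩

end IsSlotEDF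

lemma exists_isEDF (hJ : J.IsDagCollection) (hm : 0 < m) :
    ∃ S : Schedule J m, S.IsEDF (2 - 1 / (m : ℝ)) := by
  obtain ⟨g, c, h⟩ := exists_isSlotEDF hJ hm
  refine ⟨_, h.isEDF hm ?_⟩
  rw [Nat.cast_sub (by omega)]
  push_cast
  field_simp

end SporadicDAG

theorem corollary1 {n : ℕ} (τ : SporadicDAG.TaskSystem n) (m : ℕ) (hm : 0 < m)
    (h : SporadicDAG.Feasible τ m 1) :
    SporadicDAG.EDFSchedulable τ m (2 - 1 / (m : ℝ)) := by
  intro R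
  have hJ := R.isDagCollection_jobs
  obtain ⟨O, hO⟩ := h R
  exact ⟨SporadicDAG.exists_isEDF hJ hm, fun A hA => hA.meetsDeadlines hm hJ hO⟩
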